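/- Let $\Theta\subset\mathbb R^q$ be compact and $f:\mathbb R^p\times\Theta\to\mathbb R$ be continuous in $x$ and of class $C^2$ in $\beta$, with gradient $\dot f=\partial f/\partial\beta$ (continuous in $x$) and Hessian $\ddot f$ with respect to $\beta$. Let $(X_i,\varepsilon_i)_{i\ge1}$ be independent observations, each $X_i$ distributed like a random vector $X$ in $\mathbb R^p$. Let $\beta^0$ and $\beta^0_m$ $(m\ge1)$ be interior points of $\Theta$, where $\beta^0$ is identified: if $\beta\in\Theta$ and $f(X;\beta)=f(X;\beta^0)$ almost surely, then $\beta=\beta^0$. Let $k^0_m\ge1$ be integers, $T_m\in\mathbb N\cup\{\infty\}$, and $0\le\gamma<1/2$. Assume: (A1) the $\varepsilon_i$ are i.i.d. with $E\varepsilon_i=0$, $\mathrm{Var}\,\varepsilon_i=\sigma^2$ and $E|\varepsilon_i|^\nu<\infty$ for some $\nu>2$; (A2) $\ddot f(x;\beta)$ is bounded, uniformly over all $x\in\mathbb R^p$ and all $\beta$ in a neighbourhood of $\beta^0$; (A3) the errors are independent of the regressors; (A4) $f(X;\beta^0)$, $\dot f(X;\beta^0)$ and $\dot f(X;\beta^0)\dot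 f(X;\beta^0)^t$ are integrable, $B=E[\dot f(X;\beta^0)\dot f(X;\beta^0)^t]$ is positive definite, and almost surely, as $n\to\infty$, $\frac1n\sum_{i\le n}f(X_i;\beta^0)\to E f(X;\beta^0)$, $\frac1n\sum_{i\le n}\dot f(X_i;\beta^0)\to E\dot f(X;\beta^0)$ and $\frac1n\sum_{i\le n}\dot f(X_i;\beta^0)\dot f(X_i;\beta^0)^t\to B$; (A5) $f(X;\beta^0_m)$ is integrable for every $m$, and for all integers $l_m\ge0$ such that $k^0_m+l_m\le T_m$ for all large $m$, almost surely $\frac{1}{m+k^0_m+l_m}\sum_{i\le m+k^0_m+l_m}f(X_i;\beta^0_m)-E f(X;\beta^0_m)\to0$ as $m\to\infty$. Under the alternative $H_1$, $Y_i=f(X_i;\beta^0)+\varepsilon_i$ for $i\le m+k^0_m$ and $Y_i=f(X_i;\beta^0_m)+\varepsilon_i$ for $m+k^0_m<i\le m+T_m$, with $\beta^0_m\ne\beta^0$. Let $\hat\beta_m$ be a minimiser over $\Theta$ of $\sum_{j\le m}(Y_j-f(X_j;\beta))^2$, and put $\hat\sigma_m^2=\frac1{m-q}\sum_{j\le m}(Y_j-f(X_j;\hat\beta_m))^2$,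 $\hat\varepsilon_i=Y_i-f(X_i;\hat\beta_m)$ and $g(m,k,\gamma)=m^{1/2}(1+\frac km)(\frac k{k+m})^\gamma$. Suppose that $k^0_m=O(m)$; that for some $c>0$ one has $k^0_m+\lceil cm\rceil\le T_m$ for all large $m$ (this is automatic if $T_m=\infty$ for all $m$, or if $T_m/m\to\infty$; if $T_m/m\to T\in(0,\infty)$ it means $\limsup_m k^0_m/m<T$); and that for some $\delta>0$ one has $|E f(X;\beta^0_m)-E f(X;\beta^0)|\ge\delta$ for all large $m$. Then $$Z_\gamma(m)=\frac1{\hat\sigma_m}\sup_{1\le k\le T_m}\frac{\bigl|\sum_{i=m+1}^{m+k}\hat\varepsilon_i\bigr|}{g(m,k,\gamma)}\ \longrightarrow\ \infty\quad\text{in probability as } m\to\infty$$ (with $a/0=\infty$ for $a>0$ and $0/0=0$), that is, $P(Z_\gamma(m)\le K)\to0$ for every $K<\infty$. Consequently the test which rejects $H_0$ when $Z_\gamma(m)\ge c$ has asymptotic power one, $P(Z_\gamma(m)\ge c)\to1$, for every fixed critical value $c\in[0,\infty)$. -/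

import Mathlib

open MeasureTheory ProbabilityTheory Filter Topology Asymptotics
open scoped ENNReal NNReal

namespace SeqChange

variable {Ω : Type*} [MeasurableSpace Ω] {p q : ℕ}

/-! Observations are numbered from `0`: the observation which is usually called the `i`-th one
(`i = 1, 2, …`) has index `i - 1` here. So the historical sample consists of the indices `i < m`,
the first `k` monitored observations are the indices `m ≤ i < m + k`, and the change from `β⁰` to
`β⁰ₘ` takes place at the index `m + k⁰ₘ`. -/

/-- `ḟ(x; β)`, the gradient of `f` with respect to the parameter. -/
noncomputable def fdot (f : EuclideanSpace ℝ (Fin p) → EuclideanSpace ℝ (Fin q) → ℝ)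
    (x : EuclideanSpace ℝ (Fin p)) (β : EuclideanSpace ℝ (Fin q)) : EuclideanSpace ℝ (Fin q) :=
  gradient (f x) β

/-- `f̈(x; β)`, the second derivative of `f` with respect to the parameter. -/
noncomputable def fddot (f : EuclideanSpace ℝ (Fin p) → EuclideanSpace ℝ (Fin q) → ℝ)
    (x : EuclideanSpace ℝ (Fin p)) (β : EuclideanSpace ℝ (Fin q)) :
    EuclideanSpace ℝ (Fin q) →L[ℝ] EuclideanSpace ℝ (Fin q) :=
  fderiv ℝ (fdot f x) β

/-- `B = E[ḟ(X; β) ḟ(X; β)ᵗ]`. -/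
noncomputable def infoMatrix (μ : Measure Ω)
    (f : EuclideanSpace ℝ (Fin p) → EuclideanSpace ℝ (Fin q) → ℝ)
    (X₀ : Ω → EuclideanSpace ℝ (Fin p)) (β : EuclideanSpace ℝ (Fin q)) :
    Matrix (Fin q) (Fin q) ℝ :=
  Matrix.of fun a b => ∫ ω, fdot f (X₀ ω) β a * fdot f (X₀ ω) β b ∂μ

/-! ### The standing assumptions on the model -/

/-- The regression function: `Θ` is compact, `f` is continuous in `x` and `C²` in `β ∈ Θ`, `ḟ` is
continuous in `x`, and the parameter is identified at the interior point `β⁰` of `Θ`. -/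
structure RegressionModel (μ : Measure Ω) (Θ : Set (EuclideanSpace ℝ (Fin q)))
    (f : EuclideanSpace ℝ (Fin p) → EuclideanSpace ℝ (Fin q) → ℝ)
    (X₀ : Ω → EuclideanSpace ℝ (Fin p)) (β₀ : EuclideanSpace ℝ (Fin q)) : Prop where
  isCompact : IsCompact Θ
  continuous_f : ∀ β ∈ Θ, Continuous fun x => f x β
  continuous_fdot : ∀ β ∈ interior Θ, Continuous fun x => fdot f x β
  contDiffOn : ∀ x, ContDiffOn ℝ 2 (f x) Θ
  mem_interior : β₀ ∈ interior Θ
  identified : ∀ β ∈ Θ, (∀ᵐ ω ∂μ, f (X₀ ω) β = f (X₀ ω) β₀) → β = β₀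
  posDef : (infoMatrix μ f X₀ β₀).PosDef

/-- The observations `(Xᵢ, εᵢ)` are independent, and the regressors `Xᵢ` are distributed like the
generic regressor `X₀`. -/
structure IndependentObservations (μ : Measure Ω) (X : ℕ → Ω → EuclideanSpace ℝ (Fin p))
    (ε : ℕ → Ω → ℝ) (X₀ : Ω → EuclideanSpace ℝ (Fin p)) : Prop where
  measurable_X : ∀ i, Measurable (X i)
  measurable_ε : ∀ i, Measurable (ε i)
  indep : iIndepFun (fun i ω => (X i ω, ε i ω)) μ
  identDistrib_X : ∀ i, IdentDistrib (X i) X₀ μ μ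

/-- (A1): the errors are i.i.d. and centred, with variance `σ²` and a finite absolute moment of
some order `ν > 2`. -/
structure AssumptionA1 (μ : Measure Ω) (ε : ℕ → Ω → ℝ) (σ : ℝ) : Prop where
  indep : iIndepFun ε μ
  identDistrib : ∀ i, IdentDistrib (ε i) (ε 0) μ μ
  mean : ∀ i, ∫ ω, ε i ω ∂μ = 0
  variance : ∀ i, Var[ε i; μ] = σ ^ 2
  moment : ∃ ν : ℝ, 2 < ν ∧ ∀ i, Integrable (fun ω => |ε i ω| ^ ν) μ

/-- (A2): `f̈(x; β)` is bounded, for all `x` and all `β` in a neighbourhood of `β⁰`. -/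
def AssumptionA2 (f : EuclideanSpace ℝ (Fin p) → EuclideanSpace ℝ (Fin q) → ℝ)
    (β₀ : EuclideanSpace ℝ (Fin q)) : Prop :=
  ∃ C : ℝ, ∀ᶠ β in 𝓝 β₀, ∀ x, ‖fddot f x β‖ ≤ C

/-- (A3): the errors are independent of the regressors. -/
def AssumptionA3 (μ : Measure Ω) (X : ℕ → Ω → EuclideanSpace ℝ (Fin p)) (ε : ℕ → Ω → ℝ) : Prop :=
  ∀ i j, IndepFun (ε i) (X j) μ

/-- (A4): the means of `f(X; β⁰)`, `ḟ(X; β⁰)` and `ḟ(X; β⁰) ḟ(X; β⁰)ᵗ` exist, and the averages over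
the first `n` observations converge to them almost surely as `n → ∞`. -/
structure AssumptionA4 (μ : Measure Ω)
    (f : EuclideanSpace ℝ (Fin p) → EuclideanSpace ℝ (Fin q) → ℝ)
    (X : ℕ → Ω → EuclideanSpace ℝ (Fin p)) (X₀ : Ω → EuclideanSpace ℝ (Fin p))
    (β₀ : EuclideanSpace ℝ (Fin q)) : Prop where
  integrable_f : Integrable (fun ω => f (X₀ ω) β₀) μ
  integrable_fdot : Integrable (fun ω => fdot f (X₀ ω) β₀) μ
  integrable_sq : ∀ a b, Integrable (fun ω => fdot f (X₀ ω) β₀ a * fdot f (X₀ ω) β₀ b) μ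
  tendsto_f : ∀ᵐ ω ∂μ, Tendsto
    (fun n : ℕ => (n : ℝ)⁻¹ * ∑ i ∈ Finset.range n, f (X i ω) β₀) atTop
    (𝓝 (∫ ω', f (X₀ ω') β₀ ∂μ))
  tendsto_fdot : ∀ᵐ ω ∂μ, Tendsto
    (fun n : ℕ => (n : ℝ)⁻¹ • ∑ i ∈ Finset.range n, fdot f (X i ω) β₀) atTop
    (𝓝 (∫ ω', fdot f (X₀ ω') β₀ ∂μ))
  tendsto_sq : ∀ᵐ ω ∂μ, ∀ a b, Tendsto
    (fun n : ℕ => (n : ℝ)⁻¹ * ∑ i ∈ Finset.range n, fdot f (X i ω) β₀ a * fdot f (X i ω) β₀ b)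
    atTop (𝓝 (infoMatrix μ f X₀ β₀ a b))

/-- (A5): the mean of `f(X; β⁰ₘ)` exists, and the averages of `f(Xᵢ; β⁰ₘ)` over the first
`m + k⁰ₘ + l` observations approach it almost surely as `m → ∞`, for every `l`, possibly depending
on `m`, in the range `0 ≤ l ≤ Tₘ - k⁰ₘ`. -/
structure AssumptionA5 (μ : Measure Ω)
    (f : EuclideanSpace ℝ (Fin p) → EuclideanSpace ℝ (Fin q) → ℝ)
    (X : ℕ → Ω → EuclideanSpace ℝ (Fin p)) (X₀ : Ω → EuclideanSpace ℝ (Fin p))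
    (T : ℕ → ℕ∞) (k₀ : ℕ → ℕ) (β₁ : ℕ → EuclideanSpace ℝ (Fin q)) : Prop where
  integrable_f : ∀ m, Integrable (fun ω => f (X₀ ω) (β₁ m)) μ
  tendsto_f : ∀ l : ℕ → ℕ, (∀ᶠ m in atTop, ((k₀ m + l m : ℕ) : ℕ∞) ≤ T m) →
    ∀ᵐ ω ∂μ, Tendsto
      (fun m : ℕ => ((m + k₀ m + l m : ℕ) : ℝ)⁻¹ *
          ∑ i ∈ Finset.range (m + k₀ m + l m), f (X i ω) (β₁ m)
        - ∫ ω', f (X₀ ω') (β₁ m) ∂μ) atTop (𝓝 0)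

/-! ### Responses under the alternative, least squares, and the test statistic -/

/-- `Yᵢ = f(Xᵢ; βᵢ,ₘ) + εᵢ` under `H₁`: the parameter is `β⁰` on the historical sample and on the
first `k⁰ₘ` monitored observations, and `β⁰ₘ` afterwards. -/
noncomputable def response (f : EuclideanSpace ℝ (Fin p) → EuclideanSpace ℝ (Fin q) → ℝ)
    (X : ℕ → Ω → EuclideanSpace ℝ (Fin p)) (ε : ℕ → Ω → ℝ) (β₀ : EuclideanSpace ℝ (Fin q))
    (k₀ : ℕ → ℕ) (β₁ : ℕ → EuclideanSpace ℝ (Fin q)) (m i : ℕ) (ω : Ω) : ℝ :=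
  f (X i ω) (if i < m + k₀ m then β₀ else β₁ m) + ε i ω

/-- `b` is a least squares estimate over `Θ` from the historical sample of size `m`, for regressors
`x` and responses `y`. -/
def IsLeastSquares (Θ : Set (EuclideanSpace ℝ (Fin q)))
    (f : EuclideanSpace ℝ (Fin p) → EuclideanSpace ℝ (Fin q) → ℝ) (m : ℕ)
    (x : ℕ → EuclideanSpace ℝ (Fin p)) (y : ℕ → ℝ) (b : EuclideanSpace ℝ (Fin q)) : Prop :=
  b ∈ Θ ∧ IsMinOn (fun β => ∑ j ∈ Finset.range m, (y j - f (x j) β) ^ 2) Θ b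

/-- `σ̂ₘ`, where `σ̂ₘ² = (m - q)⁻¹ ∑ (Yⱼ - f(Xⱼ; β̂ₘ))²`, the sum over the historical sample. -/
noncomputable def sigmaHat (f : EuclideanSpace ℝ (Fin p) → EuclideanSpace ℝ (Fin q) → ℝ) (m : ℕ)
    (x : ℕ → EuclideanSpace ℝ (Fin p)) (y : ℕ → ℝ) (b : EuclideanSpace ℝ (Fin q)) : ℝ :=
  Real.sqrt (1 / ((m : ℝ) - q) * ∑ j ∈ Finset.range m, (y j - f (x j) b) ^ 2)

/-- The boundary `g(m, k, γ) = m^{1/2} (1 + k/m) (k/(k+m))^γ`. -/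
noncomputable def boundary (m k : ℕ) (γ : ℝ) : ℝ :=
  Real.sqrt m * (1 + (k : ℝ) / m) * ((k : ℝ) / (k + m)) ^ γ

/-- `Z_γ(m) = σ̂ₘ⁻¹ sup_{1 ≤ k ≤ Tₘ} |∑_{m < i ≤ m+k} ε̂ᵢ| / g(m, k, γ)`, with values in `[0, ∞]`,
as the supremum may be over an infinite range. -/
noncomputable def detector (f : EuclideanSpace ℝ (Fin p) → EuclideanSpace ℝ (Fin q) → ℝ) (γ : ℝ)
    (m : ℕ) (Tm : ℕ∞) (x : ℕ → EuclideanSpace ℝ (Fin p)) (y : ℕ → ℝ)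
    (b : EuclideanSpace ℝ (Fin q)) : ℝ≥0∞ :=
  (⨆ k : ℕ, ⨆ _ : 1 ≤ k ∧ (k : ℕ∞) ≤ Tm,
      ENNReal.ofReal (|∑ i ∈ Finset.Ico m (m + k), (y i - f (x i) b)| / boundary m k γ))
    / ENNReal.ofReal (sigmaHat f m x y b)

/-- Convergence in probability to infinity. -/
def TendstoInProbabilityInfty (μ : Measure Ω) (Z : ℕ → Ω → ℝ≥0∞) : Prop :=
  ∀ K : ℝ≥0, Tendsto (fun m => μ {ω | Z m ω ≤ K}) atTop (𝓝 0)

end SeqChange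

open SeqChange

namespace SeqChange

/-! It suffices to look at one monitoring time, `k = k⁰ₘ + ⌈c m⌉`, a positive fraction of `m` after
the change. There `m + k ≤ L m` for a constant `L`, so the boundary is at most `L √m`, and `σ̂ₘ`
stays bounded because the least squares fit does no worse than `β⁰`. If the residual sum is at least
a constant times `m`, the detector grows at least like `√m`.

The residual sum splits into three parts (`abs_sum_residual_ge`). The change contributes `⌈c m⌉`
times the gap of the means, up to `o(m)`, by (A4) and by (A5) at `l = 0` and `l = ⌈c m⌉`. The errors
contribute `o(m)` by the strong law. Estimation also contributes `o(m)`: by the first order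
expansion `abs_sub_sub_inner_fdot_le` it is a sum of `O(m)` times `β̂ₘ - β⁰`, so consistency without
any rate is enough.

Consistency (`eventuallyLikely_norm_sub_lt`) is Wald's argument: away from `β⁰`, the loss is bounded
below locally by truncated infima whose mean already exceeds `E ε²`, and compactness reduces this to
finitely many strong laws for the truncated losses. No integrable envelope for `f` is needed.

All probabilities are outer measures, since neither `β̂ₘ` nor the detector is assumed measurable. -/

/-- The events `A m` hold with probability tending to one; the sets need not be measurable. -/
def EventuallyLikely {Ω : Type*} [MeasurableSpace Ω] (μ : Measure Ω) (A : ℕ → Ω → Prop) : Prop :=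
  Tendsto (fun m => μ {ω | ¬ A m ω}) atTop (𝓝 0)

/-! ### Calculus of events whose probability tends to one. -/

namespace EventuallyLikely

variable {Ω : Type*} [MeasurableSpace Ω] {μ : Measure Ω}

lemma mono {A B : ℕ → Ω → Prop} (hA : EventuallyLikely μ A)
    (h : ∀ᶠ m in atTop, ∀ ω, A m ω → B m ω) : EventuallyLikely μ B := by
  refine tendsto_of_tendsto_of_tendsto_of_le_of_le' tendsto_const_nhds hA
    (Eventually.of_forall fun _ => zero_le) ?_
  filter_upwards [h] with m hm
  exact measure_mono fun ω hω hA => hω (hm ω hA)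

lemma and {A B : ℕ → Ω → Prop} (hA : EventuallyLikely μ A) (hB : EventuallyLikely μ B) :
    EventuallyLikely μ (fun m ω => A m ω ∧ B m ω) := by
  have h := Tendsto.add hA hB
  rw [add_zero] at h
  refine tendsto_of_tendsto_of_tendsto_of_le_of_le tendsto_const_nhds h
    (fun _ => zero_le) fun m => ?_
  refine le_trans (measure_mono ?_) (measure_union_le _ _)
  intro ω hω
  by_cases h1 : A m ω
  · exact Or.inr fun h2 => hω ⟨h1, h2⟩
  · exact Or.inl h1

lemma forall_mem_finset {ι : Type*} (s : Finset ι) {A : ι → ℕ → Ω → Prop}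
    (h : ∀ i ∈ s, EventuallyLikely μ (A i)) :
    EventuallyLikely μ (fun m ω => ∀ i ∈ s, A i m ω) := by
  classical
  induction s using Finset.induction_on with
  | empty => simp [EventuallyLikely]
  | insert a s _ ih =>
    refine ((h a (Finset.mem_insert_self a s)).and
      (ih fun i hi => h i (Finset.mem_insert_of_mem hi))).mono (Eventually.of_forall ?_)
    rintro m ω ⟨h1, h2⟩ i hi
    rcases Finset.mem_insert.1 hi with rfl | hi
    exacts [h1, h2 i hi]

lemma norm_sub_lt_of_tendsto_ae [IsFiniteMeasure μ] {E : Type*} [NormedAddCommGroup E]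
    {Z : ℕ → Ω → E} {z : E} (hZ : ∀ m, AEStronglyMeasurable (Z m) μ)
    (h : ∀ᵐ ω ∂μ, Tendsto (fun m => Z m ω) atTop (𝓝 z)) {η : ℝ} (hη : 0 < η) :
    EventuallyLikely μ (fun m ω => ‖Z m ω - z‖ < η) := by
  have := tendstoInMeasure_iff_norm.1 (tendstoInMeasure_of_tendsto_ae (g := fun _ => z) hZ h) η hη
  simpa only [EventuallyLikely, not_lt] using this

end EventuallyLikely

section

variable {Ω : Type*} [MeasurableSpace Ω] {μ : Measure Ω} {p q : ℕ}

/-! ### First order expansion of the regression function -/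

/-- The mean value inequality is used twice: the Hessian bound makes the gradient `C`-Lipschitz, and
then `f` minus its linear part has gradient at most `C ‖b - β₀‖` on the closed ball through `b`. -/
lemma abs_sub_sub_inner_fdot_le {f : EuclideanSpace ℝ (Fin p) → EuclideanSpace ℝ (Fin q) → ℝ}
    {x : EuclideanSpace ℝ (Fin p)} {β₀ b : EuclideanSpace ℝ (Fin q)} {r C : ℝ}
    (hf : ∀ β ∈ Metric.ball β₀ r, ContDiffAt ℝ 2 (f x) β)
    (hC : ∀ β ∈ Metric.ball β₀ r, ‖fddot f x β‖ ≤ C) (hb : ‖b - β₀‖ < r) :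
    |f x b - f x β₀ - inner ℝ (fdot f x β₀) (b - β₀)| ≤ C * ‖b - β₀‖ ^ 2 := by
  have hr : 0 < r := (norm_nonneg _).trans_lt hb
  have hC0 : 0 ≤ C := (norm_nonneg _).trans (hC β₀ (Metric.mem_ball_self hr))
  have hdiff : ∀ β ∈ Metric.ball β₀ r, DifferentiableAt ℝ (fdot f x) β := fun β hβ => by
    have h1 : ContDiffAt ℝ 1 (fderiv ℝ (f x)) β := (hf β hβ).fderiv_right (by norm_num)
    have h2 := h1.differentiableAt one_ne_zero
    exact ((InnerProductSpace.toDual ℝ (EuclideanSpace ℝ (Fin q))).symm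
      |>.toContinuousLinearEquiv.toContinuousLinearMap.differentiableAt).comp β h2
  have hlip : ∀ z ∈ Metric.closedBall β₀ ‖b - β₀‖,
      ‖fdot f x z - fdot f x β₀‖ ≤ C * ‖b - β₀‖ := fun z hz => by
    have hz' : ‖z - β₀‖ ≤ ‖b - β₀‖ := by simpa [dist_eq_norm] using hz
    have := (convex_ball β₀ r).norm_image_sub_le_of_norm_fderiv_le (f := fdot f x) (𝕜 := ℝ)
      hdiff hC (Metric.mem_ball_self hr)
      (show z ∈ Metric.ball β₀ r by rw [mem_ball_iff_norm]; exact hz'.trans_lt hb)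
    exact this.trans (by gcongr)
  have hsub : ∀ z ∈ Metric.closedBall β₀ ‖b - β₀‖, z ∈ Metric.ball β₀ r := fun z hz =>
    Metric.closedBall_subset_ball hb hz
  have key := (convex_closedBall β₀ ‖b - β₀‖).norm_image_sub_le_of_norm_hasFDerivWithin_le'
    (f := f x) (φ := innerSL ℝ (fdot f x β₀)) (f' := fun z => fderiv ℝ (f x) z)
    (C := C * ‖b - β₀‖) (x := β₀) (y := b)
    (fun z hz => ((hf z (hsub z hz)).differentiableAt two_ne_zero).hasFDerivAt.hasFDerivWithinAt)
    (fun z hz => ?_) (by simp) (by simp [dist_eq_norm])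
  · simpa [Real.norm_eq_abs, pow_two, mul_assoc] using key
  · have h1 : fderiv ℝ (f x) z = innerSL ℝ (fdot f x z) := by
      ext v
      simp [fdot, gradient]
    rw [h1, ← map_sub, innerSL_apply_norm]
    exact hlip z hz

/-! ### A strict lower bound for the expected squared residual -/

/-- If `d` is square integrable, independence and centring kill the cross term and leave `E d² > 0`.
Otherwise the right side is infinite, since `e + d` in `L²` would force `d` in `L²`. Stating the
right side as a `lintegral` thus avoids moment conditions on `d`. -/
lemma ofReal_integral_sq_lt_lintegral_add_sq [IsProbabilityMeasure μ] {e d : Ω → ℝ}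
    (he : MemLp e 2 μ) (hd : AEStronglyMeasurable d μ) (hindep : IndepFun e d μ)
    (hmean : ∫ ω, e ω ∂μ = 0) (hd0 : ¬ ∀ᵐ ω ∂μ, d ω = 0) :
    ENNReal.ofReal (∫ ω, e ω ^ 2 ∂μ) < ∫⁻ ω, ENNReal.ofReal ((e ω + d ω) ^ 2) ∂μ := by
  by_cases hd2 : MemLp d 2 μ
  · have hint : Integrable (fun ω => (e ω + d ω) ^ 2) μ := (he.add hd2).integrable_sq
    have hpos : 0 < ∫ ω, d ω ^ 2 ∂μ := by
      refine lt_of_le_of_ne (integral_nonneg fun _ => sq_nonneg _) fun h => hd0 ?_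
      have := (integral_eq_zero_iff_of_nonneg (fun _ => sq_nonneg _) hd2.integrable_sq).1 h.symm
      filter_upwards [this] with ω hω
      simpa using hω
    have hcross : ∫ ω, e ω * d ω ∂μ = 0 := by
      rw [hindep.integral_fun_mul_eq_mul_integral he.aestronglyMeasurable hd, hmean, zero_mul]
    have hed : Integrable (fun ω => e ω * d ω) μ := he.integrable_mul hd2
    have hexp : ∫ ω, (e ω + d ω) ^ 2 ∂μ = ∫ ω, e ω ^ 2 ∂μ + ∫ ω, d ω ^ 2 ∂μ := by
      have : ∀ ω, (e ω + d ω) ^ 2 = e ω ^ 2 + d ω ^ 2 + 2 * (e ω * d ω) := fun ω => by ring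
      have hsq : Integrable (fun ω => e ω ^ 2 + d ω ^ 2) μ :=
        he.integrable_sq.add hd2.integrable_sq
      simp_rw [this]
      rw [integral_add hsq (hed.const_mul 2),
        integral_add he.integrable_sq hd2.integrable_sq, integral_const_mul, hcross]
      ring
    rw [← ofReal_integral_eq_lintegral_ofReal hint (Eventually.of_forall fun _ => sq_nonneg _),
      hexp]
    have h0 : 0 ≤ ∫ ω, e ω ^ 2 ∂μ := integral_nonneg fun _ => sq_nonneg _
    exact (ENNReal.ofReal_lt_ofReal_iff (by linarith)).2 (by linarith)
  · suffices h : ∫⁻ ω, ENNReal.ofReal ((e ω + d ω) ^ 2) ∂μ = ∞ by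
      rw [h]; exact ENNReal.ofReal_lt_top
    by_contra hne
    have hm : AEStronglyMeasurable (fun ω => e ω + d ω) μ := he.aestronglyMeasurable.add hd
    have hint : Integrable (fun ω => (e ω + d ω) ^ 2) μ :=
      (lintegral_ofReal_ne_top_iff_integrable (hm.pow 2)
        (Eventually.of_forall fun _ => sq_nonneg _)).1 hne
    have hed : MemLp (fun ω => e ω + d ω) 2 μ := (memLp_two_iff_integrable_sq hm).2 hint
    refine hd2 ((hed.sub he).congr_norm hd (Eventually.of_forall fun ω => ?_))
    simp

/-! ### Bounded minorants of the squared residual -/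

/-- The squared residual, minimised over a ball of radius `1 / (n + 1)` and truncated at `n`. -/
noncomputable def truncLoss (Θ : Set (EuclideanSpace ℝ (Fin q)))
    (f : EuclideanSpace ℝ (Fin p) → EuclideanSpace ℝ (Fin q) → ℝ)
    (β₀ b : EuclideanSpace ℝ (Fin q)) (n : ℕ) (z : EuclideanSpace ℝ (Fin p) × ℝ) : ℝ≥0∞ :=
  min n (⨅ β ∈ Θ ∩ Metric.ball b (1 / ((n : ℝ) + 1)),
    ENNReal.ofReal ((z.2 + (f z.1 β₀ - f z.1 β)) ^ 2))

variable {Θ : Set (EuclideanSpace ℝ (Fin q))}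
  {f : EuclideanSpace ℝ (Fin p) → EuclideanSpace ℝ (Fin q) → ℝ} {β₀ b : EuclideanSpace ℝ (Fin q)}

/-- The infimum is over an uncountable set, but an infimum of functions continuous in `z` is upper
semicontinuous, hence measurable. -/
lemma measurable_truncLoss (hf : ∀ β ∈ Θ, Continuous fun x => f x β) (hβ₀ : β₀ ∈ Θ) (n : ℕ) :
    Measurable (truncLoss Θ f β₀ b n) := by
  refine measurable_const.min (UpperSemicontinuous.measurable ?_)
  refine upperSemicontinuous_biInf fun β hβ => Continuous.upperSemicontinuous ?_
  refine ENNReal.continuous_ofReal.comp ((continuous_snd.add ?_).pow 2)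
  exact ((hf β₀ hβ₀).comp continuous_fst).sub ((hf β hβ.1).comp continuous_fst)

lemma truncLoss_le_natCast (n : ℕ) (z : EuclideanSpace ℝ (Fin p) × ℝ) :
    truncLoss Θ f β₀ b n z ≤ n := min_le_left _ _

lemma toReal_truncLoss_le {n : ℕ} {β : EuclideanSpace ℝ (Fin q)} (hβ : β ∈ Θ)
    (hβb : β ∈ Metric.ball b (1 / ((n : ℝ) + 1))) (z : EuclideanSpace ℝ (Fin p) × ℝ) :
    (truncLoss Θ f β₀ b n z).toReal ≤ (z.2 + (f z.1 β₀ - f z.1 β)) ^ 2 :=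
  ENNReal.toReal_le_of_le_ofReal (sq_nonneg _)
    ((min_le_right _ _).trans (iInf₂_le β ⟨hβ, hβb⟩))

lemma monotone_truncLoss : Monotone (truncLoss Θ f β₀ b) := by
  intro n n' hn z
  refine min_le_min (by exact_mod_cast hn) (biInf_mono fun β hβ => ⟨hβ.1, ?_⟩)
  exact Metric.ball_subset_ball (by gcongr) hβ.2

lemma ofReal_sq_le_iSup_truncLoss {z : EuclideanSpace ℝ (Fin p) × ℝ}
    (hf : ContinuousWithinAt (f z.1) Θ b) :
    ENNReal.ofReal ((z.2 + (f z.1 β₀ - f z.1 b)) ^ 2) ≤ ⨆ n, truncLoss Θ f β₀ b n z := by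
  refine le_of_forall_lt fun c hc => ?_
  -- An infimum of values above `c'` is only known to be at least `c'`; the intermediate level keeps
  -- the inequality with `c` strict.
  obtain ⟨c', hcc', hc'⟩ := exists_between hc
  refine hcc'.trans_le ?_
  have hcont : ContinuousWithinAt
      (fun β => ENNReal.ofReal ((z.2 + (f z.1 β₀ - f z.1 β)) ^ 2)) Θ b :=
    ENNReal.continuous_ofReal.continuousAt.comp_continuousWithinAt
      ((continuousWithinAt_const.add (continuousWithinAt_const.sub hf)).pow 2)
  obtain ⟨δ, hδ, hball⟩ := Metric.mem_nhdsWithin_iff.1 (hcont (lt_mem_nhds hc'))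
  obtain ⟨n₁, hn₁⟩ := exists_nat_one_div_lt hδ
  obtain ⟨n₂, hn₂⟩ := ENNReal.exists_nat_gt (ne_top_of_lt hc')
  refine le_iSup_of_le (max n₁ n₂) (le_min (hn₂.le.trans ?_) (le_iInf₂ fun β hβ => ?_))
  · exact_mod_cast le_max_right n₁ n₂
  · refine (hball ⟨Metric.ball_subset_ball ?_ hβ.2, hβ.1⟩ : c' < _).le
    refine le_trans ?_ hn₁.le
    gcongr
    exact le_max_left n₁ n₂

/-- Monotone convergence carries the strict inequality for the full loss at `b` over to some
truncation level, where the integrand is bounded. -/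
lemma exists_lt_integral_truncLoss [IsProbabilityMeasure μ] {ξ : Ω → EuclideanSpace ℝ (Fin p)}
    {e : Ω → ℝ} (hξ : Measurable ξ) (he : Measurable e) (he2 : MemLp e 2 μ)
    (hindep : IndepFun e ξ μ) (hmean : ∫ ω, e ω ∂μ = 0)
    (hcont : ∀ β ∈ Θ, Continuous fun x => f x β) (hf : ∀ x, ContinuousOn (f x) Θ)
    (hβ₀ : β₀ ∈ Θ) (hb : b ∈ Θ) (hne : ¬ ∀ᵐ ω ∂μ, f (ξ ω) b = f (ξ ω) β₀) :
    ∃ n : ℕ, ∫ ω, e ω ^ 2 ∂μ < ∫ ω, (truncLoss Θ f β₀ b n (ξ ω, e ω)).toReal ∂μ := by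
  have hd : Measurable fun x => f x β₀ - f x b := ((hcont β₀ hβ₀).sub (hcont b hb)).measurable
  have h1 := ofReal_integral_sq_lt_lintegral_add_sq (d := fun ω => f (ξ ω) β₀ - f (ξ ω) b)
    he2 (hd.comp hξ).aestronglyMeasurable (hindep.comp measurable_id hd) hmean (fun h => hne (by
      filter_upwards [h] with ω hω
      linarith))
  have hmeas : ∀ n, Measurable fun ω => truncLoss Θ f β₀ b n (ξ ω, e ω) := fun n =>
    (measurable_truncLoss hcont hβ₀ n).comp (hξ.prodMk he)
  have h2 : ∫⁻ ω, ENNReal.ofReal ((e ω + (f (ξ ω) β₀ - f (ξ ω) b)) ^ 2) ∂μ ≤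
      ⨆ n, ∫⁻ ω, truncLoss Θ f β₀ b n (ξ ω, e ω) ∂μ := by
    rw [← lintegral_iSup hmeas fun n n' hn ω => monotone_truncLoss hn _]
    exact lintegral_mono fun ω => ofReal_sq_le_iSup_truncLoss (z := (ξ ω, e ω)) (hf _ b hb)
  obtain ⟨n, hn⟩ := lt_iSup_iff.1 (h1.trans_le h2)
  refine ⟨n, ?_⟩
  rw [integral_toReal (hmeas n).aemeasurable (Eventually.of_forall fun ω =>
    (truncLoss_le_natCast n _).trans_lt (ENNReal.natCast_lt_top n))]
  refine (ENNReal.ofReal_lt_iff_lt_toReal (integral_nonneg fun _ => sq_nonneg _) ?_).1 hn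
  refine ne_top_of_le_ne_top (ENNReal.natCast_ne_top n)
    ((lintegral_mono fun ω => truncLoss_le_natCast n _).trans ?_)
  simp

end

section

variable {Ω : Type*} [MeasurableSpace Ω] {μ : Measure Ω} {p q : ℕ}

/-! ### Averages -/

lemma EventuallyLikely.norm_average_sub_lt [IsFiniteMeasure μ] {E : Type*} [NormedAddCommGroup E]
    [NormedSpace ℝ E] {u : ℕ → Ω → E} {z : E} (hu : ∀ i, AEStronglyMeasurable (u i) μ)
    (h : ∀ᵐ ω ∂μ, Tendsto (fun n : ℕ => (n : ℝ)⁻¹ • ∑ i ∈ Finset.range n, u i ω) atTop (𝓝 z))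
    {N : ℕ → ℕ} (hN : Tendsto N atTop atTop) {η : ℝ} (hη : 0 < η) :
    EventuallyLikely μ
      (fun m ω => ‖(N m : ℝ)⁻¹ • ∑ i ∈ Finset.range (N m), u i ω - z‖ < η) :=
  EventuallyLikely.norm_sub_lt_of_tendsto_ae
    (fun _ => (Finset.aestronglyMeasurable_fun_sum _ fun i _ => hu i).const_smul _)
    (h.mono fun _ hω => hω.comp hN) hη

/-- A block sum is a difference of two initial sums, each off by at most `η` times its length. -/
lemma norm_sum_Ico_sub_smul_le {E : Type*} [NormedAddCommGroup E] [NormedSpace ℝ E] {u : ℕ → E}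
    {z : E} {a b : ℕ} {N η : ℝ} (hab : a ≤ b) (hN : (b : ℝ) ≤ N)
    (ha : ‖(a : ℝ)⁻¹ • ∑ i ∈ Finset.range a, u i - z‖ < η)
    (hb : ‖(b : ℝ)⁻¹ • ∑ i ∈ Finset.range b, u i - z‖ < η) :
    ‖∑ i ∈ Finset.Ico a b, u i - ((b : ℝ) - a) • z‖ ≤ 2 * η * N := by
  have key : ∀ n : ℕ, (n : ℝ) ≤ N → ‖(n : ℝ)⁻¹ • ∑ i ∈ Finset.range n, u i - z‖ < η →
      ‖∑ i ∈ Finset.range n, u i - (n : ℝ) • z‖ ≤ η * N := fun n hn h => by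
    have hη : 0 ≤ η := (norm_nonneg _).trans h.le
    rcases Nat.eq_zero_or_pos n with rfl | hpos
    · simpa using mul_nonneg hη (by simpa using hn)
    · have hn0 : (n : ℝ) ≠ 0 := by positivity
      have : ∑ i ∈ Finset.range n, u i - (n : ℝ) • z =
          (n : ℝ) • ((n : ℝ)⁻¹ • ∑ i ∈ Finset.range n, u i - z) := by
        rw [smul_sub, smul_inv_smul₀ hn0]
      have hN0 : 0 ≤ N := n.cast_nonneg.trans hn
      rw [this, norm_smul, Real.norm_natCast, mul_comm η]
      gcongr
  have hab' : (a : ℝ) ≤ b := by exact_mod_cast hab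
  have heq : ∑ i ∈ Finset.Ico a b, u i - ((b : ℝ) - a) • z =
      (∑ i ∈ Finset.range b, u i - (b : ℝ) • z) - (∑ i ∈ Finset.range a, u i - (a : ℝ) • z) := by
    rw [Finset.sum_Ico_eq_sub _ hab, sub_smul]
    abel
  rw [heq]
  refine (norm_sub_le _ _).trans ?_
  linarith [key a (hab'.trans hN) ha, key b hN hb]

lemma AssumptionA1.memLp_two [IsProbabilityMeasure μ] {ε : ℕ → Ω → ℝ} {σ : ℝ}
    (h : AssumptionA1 μ ε σ) {i : ℕ} (hm : Measurable (ε i)) : MemLp (ε i) 2 μ := by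
  obtain ⟨ν, hν, hint⟩ := h.moment
  have hν0 : 0 ≤ ν := by linarith
  have h1 : MemLp (ε i) (ENNReal.ofReal ν) μ := by
    refine (integrable_norm_rpow_iff hm.aestronglyMeasurable ?_ ENNReal.ofReal_ne_top).1 ?_
    · simpa using (by linarith : 0 < ν)
    · rw [ENNReal.toReal_ofReal hν0]
      exact hint i
  refine h1.mono_exponent ?_
  rw [← ENNReal.ofReal_ofNat]
  exact ENNReal.ofReal_le_ofReal hν.le

lemma ae_tendsto_average [IsProbabilityMeasure μ] {X : ℕ → Ω → EuclideanSpace ℝ (Fin p)}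
    {ε : ℕ → Ω → ℝ} {X₀ : Ω → EuclideanSpace ℝ (Fin p)} {σ : ℝ}
    (hobs : IndependentObservations μ X ε X₀) (hA1 : AssumptionA1 μ ε σ)
    (hA3 : AssumptionA3 μ X ε) {h : EuclideanSpace ℝ (Fin p) × ℝ → ℝ} (hh : Measurable h)
    (hint : Integrable (fun ω => h (X 0 ω, ε 0 ω)) μ) :
    ∀ᵐ ω ∂μ, Tendsto (fun n : ℕ => (n : ℝ)⁻¹ • ∑ i ∈ Finset.range n, h (X i ω, ε i ω)) atTop
      (𝓝 (∫ ω, h (X 0 ω, ε 0 ω) ∂μ)) := by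
  have := strong_law_ae_real (fun i ω => h (X i ω, ε i ω)) hint
    (fun i j hij => (hobs.indep.indepFun hij).comp hh hh)
    -- Only the marginal laws are assumed equal; independence of error and regressor at the same
    -- index makes the pairs identically distributed.
    (fun i => (IdentDistrib.prodMk ((hobs.identDistrib_X i).trans (hobs.identDistrib_X 0).symm)
      (hA1.identDistrib i) (hA3 i i).symm (hA3 0 0).symm).comp hh)
  simpa only [smul_eq_mul, div_eq_inv_mul] using this

/-! ### Consistency of least squares -/

/-- Wald's argument: once the truncated losses of a finite cover all beat the loss at `β₀`, an
estimate lying in one of the covering balls would contradict `hle`. -/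
lemma eventuallyLikely_norm_sub_lt [IsProbabilityMeasure μ] {Θ : Set (EuclideanSpace ℝ (Fin q))}
    {f : EuclideanSpace ℝ (Fin p) → EuclideanSpace ℝ (Fin q) → ℝ}
    {X : ℕ → Ω → EuclideanSpace ℝ (Fin p)} {ε : ℕ → Ω → ℝ}
    {X₀ : Ω → EuclideanSpace ℝ (Fin p)} {σ : ℝ} {β₀ : EuclideanSpace ℝ (Fin q)}
    (hmodel : RegressionModel μ Θ f X₀ β₀) (hobs : IndependentObservations μ X ε X₀)
    (hA1 : AssumptionA1 μ ε σ) (hA3 : AssumptionA3 μ X ε)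
    {βhat : ℕ → Ω → EuclideanSpace ℝ (Fin q)} (hmem : ∀ m ω, βhat m ω ∈ Θ)
    (hle : ∀ m ω, ∑ j ∈ Finset.range m, (ε j ω + (f (X j ω) β₀ - f (X j ω) (βhat m ω))) ^ 2 ≤
      ∑ j ∈ Finset.range m, ε j ω ^ 2) {r : ℝ} (hr : 0 < r) :
    EventuallyLikely μ (fun m ω => ‖βhat m ω - β₀‖ < r) := by
  have hβ₀ : β₀ ∈ Θ := interior_subset hmodel.mem_interior
  have hε2 : MemLp (ε 0) 2 μ := hA1.memLp_two (hobs.measurable_ε 0)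
  have hK : IsCompact (Θ \ Metric.ball β₀ r) := hmodel.isCompact.diff Metric.isOpen_ball
  have hex : ∀ b ∈ Θ \ Metric.ball β₀ r, ∃ n : ℕ,
      ∫ ω, ε 0 ω ^ 2 ∂μ < ∫ ω, (truncLoss Θ f β₀ b n (X 0 ω, ε 0 ω)).toReal ∂μ := by
    rintro b ⟨hb, hbr⟩
    refine exists_lt_integral_truncLoss (hobs.measurable_X 0) (hobs.measurable_ε 0) hε2 (hA3 0 0)
      (hA1.mean 0) hmodel.continuous_f (fun x => (hmodel.contDiffOn x).continuousOn) hβ₀ hb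
      fun h => hbr ?_
    have hset : MeasurableSet {x | f x b = f x β₀} :=
      measurableSet_eq_fun (hmodel.continuous_f b hb).measurable
        (hmodel.continuous_f β₀ hβ₀).measurable
    rw [hmodel.identified b hb ((hobs.identDistrib_X 0).ae_snd hset h)]
    exact Metric.mem_ball_self hr
  choose! n hn using hex
  obtain ⟨t, htK, ht⟩ := hK.elim_nhds_subcover
    (fun b => Metric.ball b (1 / ((n b : ℝ) + 1)))
    fun b _ => Metric.ball_mem_nhds b (by positivity)
  have hlik : EventuallyLikely μ (fun m ω => ∀ b ∈ t, ∑ j ∈ Finset.range m, ε j ω ^ 2 <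
      ∑ j ∈ Finset.range m, (truncLoss Θ f β₀ b (n b) (X j ω, ε j ω)).toReal) := by
    refine EventuallyLikely.forall_mem_finset t fun b hb => ?_
    set h : EuclideanSpace ℝ (Fin p) × ℝ → ℝ :=
      fun z => (truncLoss Θ f β₀ b (n b) z).toReal - z.2 ^ 2 with hdef
    have hmeasT : Measurable fun z => (truncLoss Θ f β₀ b (n b) z).toReal :=
      (measurable_truncLoss hmodel.continuous_f hβ₀ _).ennreal_toReal
    have hh : Measurable h := hmeasT.sub (measurable_snd.pow_const 2)
    have hpair : ∀ i, Measurable fun ω => (X i ω, ε i ω) := fun i =>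
      (hobs.measurable_X i).prodMk (hobs.measurable_ε i)
    have hintT : Integrable (fun ω => (truncLoss Θ f β₀ b (n b) (X 0 ω, ε 0 ω)).toReal) μ := by
      refine Integrable.of_bound (hmeasT.comp (hpair 0)).aestronglyMeasurable (n b)
        (Eventually.of_forall fun ω => ?_)
      rw [Real.norm_of_nonneg ENNReal.toReal_nonneg]
      exact ENNReal.toReal_le_of_le_ofReal (Nat.cast_nonneg _)
        (by simpa using truncLoss_le_natCast (n b) _)
    have hpos : 0 < ∫ ω, h (X 0 ω, ε 0 ω) ∂μ := by
      rw [hdef, integral_sub hintT hε2.integrable_sq]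
      exact sub_pos.2 (hn b (htK b hb))
    -- With the positive limit itself as tolerance, closeness to the limit means positivity of the
    -- average.
    refine (EventuallyLikely.norm_average_sub_lt
      (fun i => (hh.comp (hpair i)).aestronglyMeasurable)
      (ae_tendsto_average hobs hA1 hA3 hh (hintT.sub hε2.integrable_sq)) tendsto_id hpos).mono
      (Eventually.of_forall fun m ω hω => ?_)
    simp only [id, smul_eq_mul, Real.norm_eq_abs, hdef, Function.comp_apply,
      Finset.sum_sub_distrib] at hω
    have h1 : 0 < (m : ℝ)⁻¹ * (∑ j ∈ Finset.range m,
        (truncLoss Θ f β₀ b (n b) (X j ω, ε j ω)).toReal - ∑ j ∈ Finset.range m, ε j ω ^ 2) := by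
      linarith [(abs_lt.1 hω).1]
    exact sub_pos.1 (pos_of_mul_pos_right h1 (by positivity))
  refine hlik.mono (Eventually.of_forall fun m ω hω => ?_)
  by_contra hfar
  have hmemK : βhat m ω ∈ Θ \ Metric.ball β₀ r :=
    ⟨hmem m ω, by rwa [mem_ball_iff_norm]⟩
  obtain ⟨b, hb, hbU⟩ := Set.mem_iUnion₂.1 (ht hmemK)
  refine (hω b hb).not_ge (le_trans (Finset.sum_le_sum fun j _ => ?_) (hle m ω))
  exact toReal_truncLoss_le (hmem m ω) hbU _

/-! ### Lower bounds for the detector -/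

lemma boundary_pos {m k : ℕ} (hm : 1 ≤ m) (hk : 1 ≤ k) (γ : ℝ) : 0 < boundary m k γ := by
  have hm' : (0 : ℝ) < m := by exact_mod_cast hm
  have hk' : (0 : ℝ) < k := by exact_mod_cast hk
  unfold boundary
  positivity

lemma boundary_le {m k : ℕ} (hm : 1 ≤ m) {γ L : ℝ} (hγ : 0 ≤ γ)
    (hL : ((m + k : ℕ) : ℝ) ≤ L * m) : boundary m k γ ≤ Real.sqrt m * L := by
  have hm' : (0 : ℝ) < m := by exact_mod_cast hm
  have h1 : 1 + (k : ℝ) / m ≤ L := by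
    rw [← div_self hm'.ne', ← add_div, div_le_iff₀ hm']
    exact_mod_cast hL
  have h2 : ((k : ℝ) / (k + m)) ^ γ ≤ 1 := by
    refine Real.rpow_le_one (by positivity) ?_ hγ
    rw [div_le_one (by positivity)]
    linarith
  have h0 : 0 ≤ 1 + (k : ℝ) / m := by positivity
  unfold boundary
  calc _ ≤ Real.sqrt m * (1 + (k : ℝ) / m) * 1 := by gcongr
    _ ≤ _ := by rw [mul_one]; gcongr

lemma sigmaHat_le {f : EuclideanSpace ℝ (Fin p) → EuclideanSpace ℝ (Fin q) → ℝ} {m : ℕ}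
    {x : ℕ → EuclideanSpace ℝ (Fin p)} {y : ℕ → ℝ} {b : EuclideanSpace ℝ (Fin q)} {V : ℝ}
    (hm : 1 ≤ m) (hq : 2 * q ≤ m)
    (hV : ∑ j ∈ Finset.range m, (y j - f (x j) b) ^ 2 ≤ m * V) :
    sigmaHat f m x y b ≤ Real.sqrt (2 * V) := by
  have hm' : (0 : ℝ) < m := by exact_mod_cast hm
  have hq' : 2 * (q : ℝ) ≤ m := by exact_mod_cast hq
  have hV0 : 0 ≤ V := nonneg_of_mul_nonneg_right
    ((Finset.sum_nonneg fun _ _ => sq_nonneg _).trans hV) hm'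
  refine Real.sqrt_le_sqrt ?_
  -- From `2 q ≤ m` one has `m - q ≥ m / 2`, which is the origin of the factor `2`.
  rw [one_div, inv_mul_le_iff₀ (by linarith)]
  nlinarith

lemma lt_detector {f : EuclideanSpace ℝ (Fin p) → EuclideanSpace ℝ (Fin q) → ℝ} {γ : ℝ} {m : ℕ}
    {Tm : ℕ∞} {x : ℕ → EuclideanSpace ℝ (Fin p)} {y : ℕ → ℝ} {b : EuclideanSpace ℝ (Fin q)}
    {k : ℕ} {s : ℝ} {K : ℝ≥0} (hk : 1 ≤ k) (hkT : (k : ℕ∞) ≤ Tm)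
    (hs : sigmaHat f m x y b ≤ s)
    (h : K * s < |∑ i ∈ Finset.Ico m (m + k), (y i - f (x i) b)| / boundary m k γ) :
    (K : ℝ≥0∞) < detector f γ m Tm x y b := by
  -- As `K` is finite, this equivalence also covers `σ̂ₘ = 0`.
  rw [detector, ENNReal.lt_div_iff_mul_lt (Or.inr ENNReal.coe_ne_top)
    (Or.inl ENNReal.ofReal_ne_top)]
  refine lt_of_lt_of_le ?_ (le_iSup₂_of_le k ⟨hk, hkT⟩ le_rfl)
  rw [← ENNReal.ofReal_coe_nnreal, ← ENNReal.ofReal_mul K.coe_nonneg]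
  refine (ENNReal.ofReal_lt_ofReal_iff_of_nonneg (mul_nonneg K.coe_nonneg
    (Real.sqrt_nonneg _))).2 (lt_of_le_of_lt ?_ h)
  exact mul_le_mul_of_nonneg_left hs K.coe_nonneg

/-! ### Growth of the residual sums after the change -/

/-- Residuals split into the change of the regression function, the errors, and the effect of
estimating the parameter. -/
lemma abs_sum_residual_ge {y F₀ F₁ F e : ℕ → ℝ} {E : Type*} [NormedAddCommGroup E]
    [InnerProductSpace ℝ E] {G : ℕ → E} {v : E} {m n₀ n : ℕ} {a b : ℝ} {g : E} {N η r C δ : ℝ}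
    (hm : m ≤ n₀) (hn : n₀ ≤ n) (hN : (n : ℝ) ≤ N)
    (hy : ∀ i, y i = (if i < n₀ then F₀ i else F₁ i) + e i)
    (hF₀ : ‖(n₀ : ℝ)⁻¹ • ∑ i ∈ Finset.range n₀, F₀ i - a‖ < η)
    (hF₀' : ‖(n : ℝ)⁻¹ • ∑ i ∈ Finset.range n, F₀ i - a‖ < η)
    (hF₁ : ‖(n₀ : ℝ)⁻¹ • ∑ i ∈ Finset.range n₀, F₁ i - b‖ < η)
    (hF₁' : ‖(n : ℝ)⁻¹ • ∑ i ∈ Finset.range n, F₁ i - b‖ < η)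
    (he : ‖(m : ℝ)⁻¹ • ∑ i ∈ Finset.range m, e i - 0‖ < η)
    (he' : ‖(n : ℝ)⁻¹ • ∑ i ∈ Finset.range n, e i - 0‖ < η)
    (hG : ‖(m : ℝ)⁻¹ • ∑ i ∈ Finset.range m, G i - g‖ < 1)
    (hG' : ‖(n : ℝ)⁻¹ • ∑ i ∈ Finset.range n, G i - g‖ < 1)
    (hF : ∀ i, |F i - F₀ i - inner ℝ (G i) v| ≤ C * ‖v‖ ^ 2) (hC : 0 ≤ C)
    (hv : ‖v‖ ≤ r) (hr : r ≤ 1) (hδ : δ ≤ |b - a|) :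
    ((n : ℝ) - n₀) * δ - (6 * η + r * (2 + ‖g‖ + C)) * N ≤
      |∑ i ∈ Finset.Ico m n, (y i - F i)| := by
  have hmn := hm.trans hn
  have hn' : (n₀ : ℝ) ≤ n := by exact_mod_cast hn
  have hm' : (m : ℝ) ≤ n := by exact_mod_cast hmn
  have hm0 : (0 : ℝ) ≤ m := m.cast_nonneg
  have hN0 : 0 ≤ N := n.cast_nonneg.trans hN
  have hr0 : 0 ≤ r := (norm_nonneg v).trans hv
  -- The first three estimates cost `2 η N` each, hence `6 η`. For the gradients tolerance `1` is
  -- enough, because their sum is paired with the small vector `v`.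
  have h0 := norm_sum_Ico_sub_smul_le hn hN hF₀ hF₀'
  have h1 := norm_sum_Ico_sub_smul_le hn hN hF₁ hF₁'
  have h2 := norm_sum_Ico_sub_smul_le hmn hN he he'
  have h3 := norm_sum_Ico_sub_smul_le hmn hN hG hG'
  have hGsum : ‖∑ i ∈ Finset.Ico m n, G i‖ ≤ (2 + ‖g‖) * N := by
    have h4 : ‖((n : ℝ) - m) • g‖ ≤ N * ‖g‖ := by
      rw [norm_smul, Real.norm_of_nonneg (by linarith)]
      gcongr
      linarith
    linarith [norm_le_norm_sub_add (∑ i ∈ Finset.Ico m n, G i) (((n : ℝ) - m) • g)]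
  have hest : |∑ i ∈ Finset.Ico m n, (F i - F₀ i)| ≤ r * (2 + ‖g‖ + C) * N := by
    have heq : ∑ i ∈ Finset.Ico m n, (F i - F₀ i) =
        ∑ i ∈ Finset.Ico m n, (F i - F₀ i - inner ℝ (G i) v) +
          inner ℝ (∑ i ∈ Finset.Ico m n, G i) v := by
      rw [sum_inner, ← Finset.sum_add_distrib]
      simp
    have h5 : |∑ i ∈ Finset.Ico m n, (F i - F₀ i - inner ℝ (G i) v)| ≤ N * (C * (1 * r)) := by
      refine (Finset.abs_sum_le_sum_abs _ _).trans
        ((Finset.sum_le_card_nsmul _ _ _ fun i _ => hF i).trans ?_)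
      rw [nsmul_eq_mul, Nat.card_Ico, Nat.cast_sub hmn, pow_two]
      have : (n : ℝ) - m ≤ N := by linarith
      gcongr
      exact hv.trans hr
    have h6 : |inner ℝ (∑ i ∈ Finset.Ico m n, G i) v| ≤ (2 + ‖g‖) * N * r :=
      (abs_real_inner_le_norm _ _).trans (by gcongr)
    rw [heq]
    refine (abs_add_le _ _).trans ((add_le_add h5 h6).trans (le_of_eq ?_))
    ring
  have hsplit : ∑ i ∈ Finset.Ico m n, (y i - F i) =
      ((∑ i ∈ Finset.Ico n₀ n, F₁ i) - ∑ i ∈ Finset.Ico n₀ n, F₀ i) +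
        ∑ i ∈ Finset.Ico m n, e i - ∑ i ∈ Finset.Ico m n, (F i - F₀ i) := by
    rw [← Finset.sum_sub_distrib]
    have h7 : ∑ i ∈ Finset.Ico n₀ n, (F₁ i - F₀ i) =
        ∑ i ∈ Finset.Ico m n, ((if i < n₀ then F₀ i else F₁ i) - F₀ i) := by
      have h8 : ∑ i ∈ Finset.Ico m n₀, ((if i < n₀ then F₀ i else F₁ i) - F₀ i) = 0 :=
        Finset.sum_eq_zero fun i hi => by rw [if_pos (Finset.mem_Ico.1 hi).2, sub_self]
      rw [← Finset.sum_Ico_consecutive _ hm hn, h8, zero_add]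
      refine Finset.sum_congr rfl fun i hi => ?_
      rw [if_neg (not_lt.2 (Finset.mem_Ico.1 hi).1)]
    rw [h7, ← Finset.sum_add_distrib, ← Finset.sum_sub_distrib]
    refine Finset.sum_congr rfl fun i _ => ?_
    rw [hy]
    ring
  have hgap : ((n : ℝ) - n₀) * δ ≤ |((n : ℝ) - n₀) * (b - a)| := by
    rw [abs_mul, abs_of_nonneg (sub_nonneg.2 hn')]
    gcongr
  simp only [Real.norm_eq_abs, smul_eq_mul, mul_zero, sub_zero] at h0 h1 h2
  rw [hsplit]
  have ⟨h0a, h0b⟩ := abs_le.1 h0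
  have ⟨h1a, h1b⟩ := abs_le.1 h1
  have ⟨h2a, h2b⟩ := abs_le.1 h2
  have ⟨h3a, h3b⟩ := abs_le.1 hest
  -- The sign of the gap is unknown, so the sum is bounded below through itself or through its
  -- negative.
  rcases abs_cases (((n : ℝ) - n₀) * (b - a)) with ⟨h, _⟩ | ⟨h, _⟩
  · refine le_trans ?_ (le_abs_self _)
    linarith
  · refine le_trans ?_ (neg_le_abs _)
    linarith

end

end SeqChange

/-! ### The detector at the time `k⁰ₘ + ⌈c m⌉`. -/

theorem mainTheorem2 {Ω : Type*} [MeasurableSpace Ω] (μ : Measure Ω) [IsProbabilityMeasure μ]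
    {p q : ℕ} (Θ : Set (EuclideanSpace ℝ (Fin q)))
    (f : EuclideanSpace ℝ (Fin p) → EuclideanSpace ℝ (Fin q) → ℝ)
    (X : ℕ → Ω → EuclideanSpace ℝ (Fin p)) (ε : ℕ → Ω → ℝ)
    (X₀ : Ω → EuclideanSpace ℝ (Fin p)) (σ : ℝ)
    (β₀ : EuclideanSpace ℝ (Fin q)) (T : ℕ → ℕ∞)
    (k₀ : ℕ → ℕ) (β₁ : ℕ → EuclideanSpace ℝ (Fin q))
    (βhat : ℕ → Ω → EuclideanSpace ℝ (Fin q)) (γ : ℝ)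
    -- the model and its standing assumptions
    (hmodel : RegressionModel μ Θ f X₀ β₀)
    (hobs : IndependentObservations μ X ε X₀)
    (hA1 : AssumptionA1 μ ε σ) (hA2 : AssumptionA2 f β₀) (hA3 : AssumptionA3 μ X ε)
    (hA4 : AssumptionA4 μ f X X₀ β₀) (hA5 : AssumptionA5 μ f X X₀ T k₀ β₁)
    (hγ₀ : 0 ≤ γ) (hγ₁ : γ < 1 / 2)
    -- the alternative: a change from `β⁰` to `β⁰ₘ` after `k⁰ₘ ≥ 1` monitored observations
    (hk₀ : ∀ m, 1 ≤ k₀ m) (hβ₁ : ∀ m, β₁ m ∈ interior Θ) (hne : ∀ m, β₁ m ≠ β₀)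
    (hk₀O : (fun m => (k₀ m : ℝ)) =O[atTop] (fun m : ℕ => (m : ℝ)))
    -- at least `c m` observations are monitored after the change
    (hT : ∃ c : ℝ, 0 < c ∧ ∀ᶠ m : ℕ in atTop, ((k₀ m + ⌈c * m⌉₊ : ℕ) : ℕ∞) ≤ T m)
    -- the means before and after the change differ, uniformly in `m`
    (hgap : ∃ δ : ℝ, 0 < δ ∧ ∀ᶠ m : ℕ in atTop,
      δ ≤ |(∫ ω, f (X₀ ω) (β₁ m) ∂μ) - ∫ ω, f (X₀ ω) β₀ ∂μ|)
    -- `β̂ₘ` is a least squares estimator on the historical sample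
    (hLS : ∀ m ω, IsLeastSquares Θ f m (fun i => X i ω)
      (fun i => response f X ε β₀ k₀ β₁ m i ω) (βhat m ω)) :
    TendstoInProbabilityInfty μ (fun m ω => detector f γ m (T m) (fun i => X i ω)
      (fun i => response f X ε β₀ k₀ β₁ m i ω) (βhat m ω)) ∧
    ∀ c : ℝ≥0, Tendsto (fun m => μ {ω | (c : ℝ≥0∞) ≤ detector f γ m (T m) (fun i => X i ω)
      (fun i => response f X ε β₀ k₀ β₁ m i ω) (βhat m ω)}) atTop (𝓝 1) := by
  have hβ₀Θ : β₀ ∈ Θ := interior_subset hmodel.mem_interior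
  have hmain : TendstoInProbabilityInfty μ (fun m ω => detector f γ m (T m) (fun i => X i ω)
      (fun i => response f X ε β₀ k₀ β₁ m i ω) (βhat m ω)) := by
    intro K
    obtain ⟨C, hC⟩ := hA2
    obtain ⟨r₁, hr₁, hball⟩ := Metric.eventually_nhds_iff_ball.1
      (hC.and (isOpen_interior.mem_nhds hmodel.mem_interior))
    have hC0 : 0 ≤ C := (norm_nonneg _).trans ((hball β₀ (Metric.mem_ball_self hr₁)).1 0)
    obtain ⟨c, hc, hcT⟩ := hT
    obtain ⟨δ, hδ, hgap⟩ := hgap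
    obtain ⟨A, hA, hkA⟩ := hk₀O.exists_pos
    -- The three summands bound `m`, `k₀ m` and `⌈c m⌉` relative to `m ≥ 1`; the extra `1` pays for
    -- rounding up.
    set L : ℝ := 1 + A + (c + 1) with hL
    have hL0 : 0 < L := by positivity
    set g := ∫ ω, fdot f (X₀ ω) β₀ ∂μ with hg
    -- `η` and `r` are chosen so that the averaging error and the estimation effect each cost at
    -- most `c δ m / 4`, leaving half of the drift `c δ m`. The other bounds on `r` keep `β̂ₘ` in
    -- the ball of the expansion and make `‖v‖² ≤ r`.
    set η : ℝ := c * δ / (24 * L) with hηdef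
    have hη : 0 < η := by positivity
    set D : ℝ := 2 + ‖g‖ + C with hD
    have hD0 : 0 < D := by positivity
    set r : ℝ := min (min 1 (r₁ / 2)) (c * δ / (4 * L * D)) with hrdef
    have hr : 0 < r := by positivity
    have hr1 : r ≤ 1 := (min_le_left _ _).trans (min_le_left _ _)
    have hrr₁ : r ≤ r₁ / 2 := (min_le_left _ _).trans (min_le_right _ _)
    have hrD : r * D * L ≤ c * δ / 4 := by
      calc r * D * L ≤ c * δ / (4 * L * D) * D * L := by
            gcongr
            exact min_le_right _ _
        _ = c * δ / 4 := by field_simp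
    have hηL : 6 * η * L = c * δ / 4 := by
      rw [hηdef]
      field_simp
      norm_num
    set V : ℝ := ∫ ω, ε 0 ω ^ 2 ∂μ with hV
    set s : ℝ := Real.sqrt (2 * (V + 1)) with hs
    set n₀ : ℕ → ℕ := fun m => m + k₀ m with hn₀
    set n : ℕ → ℕ := fun m => m + k₀ m + ⌈c * m⌉₊ with hn
    have hn₀top : Tendsto n₀ atTop atTop :=
      tendsto_atTop_mono (fun m => Nat.le_add_right m _) tendsto_id
    have hntop : Tendsto n atTop atTop :=
      tendsto_atTop_mono (fun m => Nat.le_add_right (n₀ m) _) hn₀top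
    have hε2 : MemLp (ε 0) 2 μ := hA1.memLp_two (hobs.measurable_ε 0)
    have hβ₁Θ : ∀ m, β₁ m ∈ Θ := fun m => interior_subset (hβ₁ m)
    -- averages which are close to their limits
    have hf0m : ∀ i, AEStronglyMeasurable (fun ω => f (X i ω) β₀) μ := fun i =>
      ((hmodel.continuous_f β₀ hβ₀Θ).measurable.comp (hobs.measurable_X i)).aestronglyMeasurable
    have hfdm : ∀ i, AEStronglyMeasurable (fun ω => fdot f (X i ω) β₀) μ := fun i =>
      ((hmodel.continuous_fdot β₀ hmodel.mem_interior).measurable.comp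
        (hobs.measurable_X i)).aestronglyMeasurable
    have hεm : ∀ i, AEStronglyMeasurable (ε i) μ := fun i =>
      (hobs.measurable_ε i).aestronglyMeasurable
    have hF₀ := fun {N : ℕ → ℕ} (hN : Tendsto N atTop atTop) =>
      EventuallyLikely.norm_average_sub_lt (u := fun i ω => f (X i ω) β₀) hf0m hA4.tendsto_f hN hη
    have hG := fun {N : ℕ → ℕ} (hN : Tendsto N atTop atTop) =>
      EventuallyLikely.norm_average_sub_lt (u := fun i ω => fdot f (X i ω) β₀) (z := g) hfdm hA4.tendsto_fdot hN one_pos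
    have hslln := ae_tendsto_average hobs hA1 hA3 (h := fun z => z.2) measurable_snd
      (hε2.integrable one_le_two)
    rw [hA1.mean 0] at hslln
    have he := fun {N : ℕ → ℕ} (hN : Tendsto N atTop atTop) =>
      EventuallyLikely.norm_average_sub_lt (u := ε) (z := 0) hεm hslln hN hη
    have hslln2 := ae_tendsto_average hobs hA1 hA3 (h := fun z => z.2 ^ 2)
      (measurable_snd.pow_const 2) hε2.integrable_sq
    have hsq := EventuallyLikely.norm_average_sub_lt (u := fun i ω => ε i ω ^ 2) (z := V)
      (fun i => (hεm i).pow 2) hslln2 tendsto_id one_pos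
    have hF₁ : ∀ l : ℕ → ℕ, (∀ᶠ m in atTop, ((k₀ m + l m : ℕ) : ℕ∞) ≤ T m) →
        EventuallyLikely μ fun m ω => ‖((m + k₀ m + l m : ℕ) : ℝ)⁻¹ •
          ∑ i ∈ Finset.range (m + k₀ m + l m), f (X i ω) (β₁ m)
            - ∫ ω', f (X₀ ω') (β₁ m) ∂μ‖ < η := fun l hl => by
      refine (EventuallyLikely.norm_sub_lt_of_tendsto_ae (fun m => ?_)
        (hA5.tendsto_f l hl) hη).mono (Eventually.of_forall fun m ω hω => ?_)
      · exact ((Finset.aestronglyMeasurable_fun_sum _ fun i _ =>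
          ((hmodel.continuous_f _ (hβ₁Θ m)).measurable.comp
            (hobs.measurable_X i)).aestronglyMeasurable).const_mul _).sub
              aestronglyMeasurable_const
      · simpa only [sub_zero, smul_eq_mul] using hω
    -- The choice `l = 0` gives the average up to the change point; subtracting it isolates the
    -- block after the change.
    have hF₁n₀ := hF₁ (fun _ => 0) (by
      filter_upwards [hcT] with m hm
      exact le_trans (by gcongr; exact Nat.zero_le _) hm)
    -- the estimator
    have hres : ∀ m ω (β : EuclideanSpace ℝ (Fin q)),
        ∑ j ∈ Finset.range m, (response f X ε β₀ k₀ β₁ m j ω - f (X j ω) β) ^ 2 =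
          ∑ j ∈ Finset.range m, (ε j ω + (f (X j ω) β₀ - f (X j ω) β)) ^ 2 := fun m ω β => by
      refine Finset.sum_congr rfl fun j hj => ?_
      rw [response, if_pos ((Finset.mem_range.1 hj).trans_le (Nat.le_add_right _ _))]
      ring
    have hle : ∀ m ω, ∑ j ∈ Finset.range m,
        (ε j ω + (f (X j ω) β₀ - f (X j ω) (βhat m ω))) ^ 2 ≤
          ∑ j ∈ Finset.range m, ε j ω ^ 2 := fun m ω => by
      have := isMinOn_iff.1 (hLS m ω).2 β₀ hβ₀Θ
      simp only [hres] at this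
      simpa using this
    have hcons := eventuallyLikely_norm_sub_lt hmodel hobs hA1 hA3 (fun m ω => (hLS m ω).1) hle hr
    -- sample sizes
    have hroot : ∀ᶠ m : ℕ in atTop, K * s < c * δ / (2 * L) * Real.sqrt m :=
      ((Real.tendsto_sqrt_atTop.comp tendsto_natCast_atTop_atTop).const_mul_atTop
        (by positivity)).eventually_gt_atTop _
    have hlik := (((hF₀ hn₀top).and (hF₀ hntop)).and (hF₁n₀.and (hF₁ _ hcT))).and
      ((((he tendsto_id).and (he hntop)).and ((hG tendsto_id).and (hG hntop))).and
        (hsq.and hcons))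
    suffices h : EventuallyLikely μ (fun m ω => (K : ℝ≥0∞) < detector f γ m (T m)
        (fun i => X i ω) (fun i => response f X ε β₀ k₀ β₁ m i ω) (βhat m ω)) by
      simpa only [EventuallyLikely, not_lt] using h
    refine hlik.mono ?_
    filter_upwards [hkA.bound, hcT, hgap, hroot, eventually_ge_atTop 1,
      eventually_ge_atTop (2 * q)] with m hkm hTm hgapm hrootm hm1 hmq ω hω
    obtain ⟨⟨⟨h1, h2⟩, h3, h4⟩, ⟨⟨h5, h6⟩, h7, h8⟩, h9, h10⟩ := hω
    have hm0 : (0 : ℝ) < m := by exact_mod_cast hm1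
    have hm1' : (1 : ℝ) ≤ m := by exact_mod_cast hm1
    have hnL : (n m : ℝ) ≤ L * m := by
      have h11 : (k₀ m : ℝ) ≤ A * m := by simpa using hkm
      have h12 := Nat.ceil_lt_add_one (mul_pos hc hm0).le
      simp only [hn, Nat.cast_add]
      rw [hL]
      nlinarith
    have hdiff : c * m ≤ (n m : ℝ) - n₀ m := by
      have := Nat.le_ceil (c * (m : ℝ))
      simp only [hn, hn₀, Nat.cast_add]
      linarith
    have hsum := abs_sum_residual_ge (y := fun i => response f X ε β₀ k₀ β₁ m i ω)
      (F := fun i => f (X i ω) (βhat m ω)) (C := C) (v := βhat m ω - β₀)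
      (Nat.le_add_right m (k₀ m)) (Nat.le_add_right (n₀ m) _) hnL
      (fun i => by simp only [response, apply_ite (f (X i ω))]) h1 h2 (by simpa using h3) h4
      h5 h6 h7 h8
      (fun i => abs_sub_sub_inner_fdot_le (r := r₁)
        (fun β hβ => (hmodel.contDiffOn _).contDiffAt (mem_interior_iff_mem_nhds.1 (hball β hβ).2))
        (fun β hβ => (hball β hβ).1 _) (by linarith))
      hC0 h10.le hr1 hgapm
    have hlow : c * δ / 2 * m ≤ |∑ i ∈ Finset.Ico m (n m),
        (response f X ε β₀ k₀ β₁ m i ω - f (X i ω) (βhat m ω))| := by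
      refine le_trans ?_ hsum
      have h13 : c * m * δ ≤ ((n m : ℝ) - n₀ m) * δ := by gcongr
      have h14 : (6 * η + r * D) * (L * m) ≤ c * δ / 2 * m := by
        rw [← mul_assoc]
        gcongr
        linarith
      linarith
    have hk1 : 1 ≤ k₀ m + ⌈c * m⌉₊ := (hk₀ m).trans (Nat.le_add_right _ _)
    refine lt_detector hk1 hTm (s := s) (sigmaHat_le hm1 hmq ?_) ?_
    · rw [hres]
      refine (hle m ω).trans ?_
      have h15 := (abs_lt.1 h9).2.le
      simp only [id, smul_eq_mul, tsub_le_iff_right] at h15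
      rw [inv_mul_le_iff₀ hm0] at h15
      rwa [add_comm V]
    · rw [← add_assoc, lt_div_iff₀ (boundary_pos hm1 hk1 γ)]
      have hb := boundary_le (γ := γ) (k := k₀ m + ⌈c * m⌉₊) hm1 hγ₀ (L := L)
        (by rw [← add_assoc]; exact hnL)
      have hroot0 : 0 < Real.sqrt m := Real.sqrt_pos.2 hm0
      calc K * s * boundary m (k₀ m + ⌈c * m⌉₊) γ ≤ K * s * (Real.sqrt m * L) := by gcongr
        _ < c * δ / (2 * L) * Real.sqrt m * (Real.sqrt m * L) := by gcongr
        _ = c * δ / 2 * (Real.sqrt m * Real.sqrt m) := by field_simp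
        _ = c * δ / 2 * m := by rw [Real.mul_self_sqrt hm0.le]
        _ ≤ _ := hlow
  refine ⟨hmain, fun c => ?_⟩
  have hlim := ENNReal.Tendsto.sub (tendsto_const_nhds (x := (1 : ℝ≥0∞)) (f := atTop (α := ℕ)))
    (hmain c) (Or.inl ENNReal.one_ne_top)
  rw [tsub_zero] at hlim
  refine tendsto_of_tendsto_of_tendsto_of_le_of_le hlim tendsto_const_nhds (fun m => ?_)
    fun m => prob_le_one
  -- Subadditivity replaces passing to complements, so measurability of the events is not needed.
  rw [tsub_le_iff_right, ← measure_univ (μ := μ)]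
  refine (measure_mono fun ω _ => ?_).trans (measure_union_le _ _)
  exact le_total (c : ℝ≥0∞) _
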